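/- Let $G$ be a finite noncyclic nilpotent group of order $n=p_1^{\alpha_1}p_2^{\alpha_2}\cdots p_r^{\alpha_r}$, where $r\geq 2$, $p_1<p_2<\cdots<p_r$ are primes and $\alpha_1,\ldots,\alpha_r\geq 1$. Write $[r]=\{1,\ldots,r\}$, let $P_i$ be the unique Sylow $p_i$-subgroup of $G$, and let $J=\{i\in[r]: P_i\text{ is noncyclic}\}$. Suppose that the center $Z(P_j)$ is noncyclic for every $j\in J$. Let $\mathcal{P}(G)$ be the power graph of $G$, that is, the simple graph with vertex set $G$ in which two distinct vertices are adjacent if and only if one of them is a positive power of the other; let $\deg(x)$ be the degree of a vertex $x$ and $\delta(\mathcal{P}(G))$ the minimum degree of this graph. A maximal cyclic subgroup of $G$ is a cyclic subgroup not properly contained in any cyclic subgroup of $G$; let $\mathcal{M}(G)$ be the set of all of them. Let $\phi$ denote Euler's totient function. Then the following hold. (i) If $J\neq[r]$ and $2\phi\left(\prod_{i\in[r]}p_i\right)\geq\prod_{i\in[r]}p_i$, then there exists $k\in[r]\setminus J$ such that $\delta(\mathcal{P}(G))=\deg\left(y^{p_k^{\alpha_k}}\right)$ for every $y\in G$ such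 that $\langle y\rangle\in\mathcal{M}(G)$ and $\langle y\rangle$ is of minimum order among the elements of $\mathcal{M}(G)$. (ii) If $J=[r]$ and $2\phi\left(\prod_{i\in[r]\setminus\{l\}}p_i\right)\geq\prod_{i\in[r]\setminus\{l\}}p_i$ for every $l\in[r]$, then $\delta(\mathcal{P}(G))=\deg(y)$ for every $y\in G$ such that $\langle y\rangle\in\mathcal{M}(G)$ and $\langle y\rangle$ is of minimum order among the elements of $\mathcal{M}(G)$. -/

import Mathlib

/-- The power graph of a group: distinct elements are adjacent iff one of them is a positive
power of the other. -/
def powerGraph (G : Type*) [Group G] : SimpleGraph G :=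
  SimpleGraph.fromRel fun x y => ∃ m : ℕ, 0 < m ∧ y = x ^ m

/-- A maximal cyclic subgroup: a cyclic subgroup not properly contained in any cyclic subgroup. -/
def IsMaximalCyclic {G : Type*} [Group G] (M : Subgroup G) : Prop :=
  Maximal (fun H : Subgroup G => IsCyclic H) M

/-- A maximal cyclic subgroup whose order is minimum among all maximal cyclic subgroups. -/
def IsMinOrderMaximalCyclic {G : Type*} [Group G] (M : Subgroup G) : Prop :=
  IsMaximalCyclic M ∧ ∀ K : Subgroup G, IsMaximalCyclic K → Nat.card M ≤ Nat.card K

open scoped Classical in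
/-- The prime divisors of the order of `G` for which a Sylow subgroup is noncyclic (in a finite
nilpotent group there is exactly one Sylow `p`-subgroup for each prime `p`). -/
noncomputable def noncyclicPrimes (G : Type*) [Group G] : Finset ℕ :=
  (Nat.card G).primeFactors.filter fun p => ∃ P : Sylow p G, ¬ IsCyclic (P : Subgroup G)

open Subgroup

/-! The closed neighbourhood of x is the union of ⟨x⟩ and {y : x ∈ ⟨y⟩}, which meet in the
generators of ⟨x⟩; hence deg x + 1 = o(x) - φ(o(x)) + `overCard x`. Over the Sylow decomposition
each of these three terms is a product. Write a, f, N for their local factors and m for the least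
order of a maximal cyclic subgroup of the Sylow factor; the theorem becomes a lower bound for ∏ a -
∏ f + ∏ N.

If a ≥ m, then f = a(1 - 1/p) ≤ N. If a < m and the center is noncyclic, a central element of order
p outside a cyclic overgroup gives N ≥ f + p(m - a) ≥ (p - 1)m (`IsPGroup.totient_add_le_overCard`).
In a cyclic factor m is the full order, and N ≥ m - a/p (`IsPGroup.card_le_overCard_add`).

A generator of a minimum-order maximal cyclic subgroup has N = f everywhere, so its degree plus one
is ∏ m. Killing its component at a cyclic factor k gives ∏_{i≠k} m + (m_k - 1) ∏_{i≠k} m(1 - 1/p)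
instead. The totient conditions say that products of 1 - 1/p are at least 1/2, a loss that is repaid
by the factor 2 gained at a noncyclic component with a < m and p odd. The comparisons are
`prod_le_of_forall_noncyclic` and `exists_prod_erase_le`. -/

/-- The number of elements `y` such that `x` lies in the cyclic subgroup generated by `y`. -/
noncomputable def overCard {G : Type*} [Group G] (x : G) : ℕ :=
  Nat.card {y : G // x ∈ zpowers y}

/-- An element that generates a maximal cyclic subgroup. -/
def GeneratesMaximalCyclic {G : Type*} [Group G] (y : G) : Prop :=
  ∀ z : G, y ∈ zpowers z → z ∈ zpowers y

/-! ### Cyclic subgroups and the degree formula. -/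

section Basic

variable {G : Type*} [Group G]

theorem isMaximalCyclic_zpowers_iff {y : G} :
    IsMaximalCyclic (zpowers y) ↔ GeneratesMaximalCyclic y := by
  constructor
  · intro h z hz
    exact zpowers_le.1 (h.2 (inferInstance : IsCyclic (zpowers z)) (zpowers_le.2 hz))
  · intro h
    refine ⟨(inferInstance : IsCyclic (zpowers y)), fun H hH hle => ?_⟩
    obtain ⟨z, rfl⟩ := (Subgroup.isCyclic_iff_exists_zpowers_eq_top H).1 hH
    exact zpowers_le.2 (h z (zpowers_le.1 hle))

theorem IsMaximalCyclic.exists_zpowers_eq {M : Subgroup G} (h : IsMaximalCyclic M) :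
    ∃ z, GeneratesMaximalCyclic z ∧ zpowers z = M := by
  obtain ⟨z, rfl⟩ := (Subgroup.isCyclic_iff_exists_zpowers_eq_top M).1 h.1
  exact ⟨z, isMaximalCyclic_zpowers_iff.1 h, rfl⟩

theorem isMinOrderMaximalCyclic_zpowers_iff {y : G} :
    IsMinOrderMaximalCyclic (zpowers y) ↔
      GeneratesMaximalCyclic y ∧ ∀ z : G, GeneratesMaximalCyclic z → orderOf y ≤ orderOf z := by
  unfold IsMinOrderMaximalCyclic
  rw [isMaximalCyclic_zpowers_iff]
  refine and_congr_right fun _ => ⟨fun h z hz => ?_, fun h K hK => ?_⟩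
  · simpa [Nat.card_zpowers] using h _ (isMaximalCyclic_zpowers_iff.2 hz)
  · obtain ⟨z, hz, rfl⟩ := hK.exists_zpowers_eq
    simpa [Nat.card_zpowers] using h z hz

/-- In a finite group every element lies in a maximal cyclic subgroup. -/
theorem exists_generatesMaximalCyclic [Finite G] (x : G) :
    ∃ w : G, GeneratesMaximalCyclic w ∧ x ∈ zpowers w := by
  obtain ⟨M, hM⟩ := Set.Finite.exists_le_maximal
    (s := {H : Subgroup G | IsCyclic H}) (Set.toFinite _) (a := zpowers x)
    (inferInstance : IsCyclic (zpowers x))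
  obtain ⟨w, hw, rfl⟩ := IsMaximalCyclic.exists_zpowers_eq (M := M) hM.2
  exact ⟨w, hw, zpowers_le.1 hM.1⟩

/-- A finite cyclic group has one subgroup per order, so inside ⟨w⟩ containment is divisibility of
orders. -/
theorem mem_zpowers_iff_orderOf_dvd [Finite G] {w x y : G} (hx : x ∈ zpowers w)
    (hy : y ∈ zpowers w) : x ∈ zpowers y ↔ orderOf x ∣ orderOf y := by
  refine ⟨orderOf_dvd_of_mem_zpowers, fun h => ?_⟩
  obtain ⟨i, rfl⟩ := mem_powers_iff_mem_zpowers.2 hx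
  obtain ⟨j, rfl⟩ := mem_powers_iff_mem_zpowers.2 hy
  simp only [orderOf_pow] at h ⊢
  have hn : 0 < orderOf w := orderOf_pos w
  have hdvd : (orderOf w).gcd j ∣ i := by
    refine dvd_trans ?_ (Nat.gcd_dvd_right (orderOf w) i)
    obtain ⟨c, hc⟩ := h
    have hi := Nat.div_mul_cancel (Nat.gcd_dvd_left (orderOf w) i)
    have hj := Nat.div_mul_cancel (Nat.gcd_dvd_left (orderOf w) j)
    rw [hc, mul_assoc] at hj
    refine ⟨c, Nat.eq_of_mul_eq_mul_left (Nat.pos_of_ne_zero fun h0 => ?_)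
      (hi.trans (hj.symm.trans (by rw [mul_comm c])))⟩
    rw [h0, zero_mul] at hi
    omega
  obtain ⟨c, hc⟩ := hdvd
  -- Bézout: the gcd is a combination of the order of w, which contributes nothing, and j.
  have hg : w ^ (orderOf w).gcd j ∈ zpowers (w ^ j) := by
    refine mem_zpowers_iff.2 ⟨(orderOf w).gcdB j, ?_⟩
    rw [← zpow_natCast w ((orderOf w).gcd j), Nat.gcd_eq_gcd_ab, zpow_add, zpow_mul, zpow_mul]
    simp
  rw [hc, pow_mul]
  exact pow_mem hg c

theorem mem_zpowers_and_mem_zpowers_iff [Finite G] {x y : G} :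
    (y ∈ zpowers x ∧ x ∈ zpowers y) ↔ y ∈ zpowers x ∧ orderOf y = orderOf x := by
  refine and_congr_right fun hy => ⟨fun h => ?_, fun h => ?_⟩
  · exact Nat.dvd_antisymm (orderOf_dvd_of_mem_zpowers hy) (orderOf_dvd_of_mem_zpowers h)
  · exact (mem_zpowers_iff_orderOf_dvd (mem_zpowers x) hy).2 h.symm.dvd

theorem card_generators_zpowers [Finite G] (x : G) :
    Nat.card {y : G // y ∈ zpowers x ∧ x ∈ zpowers y} = (orderOf x).totient := by
  classical
  have := Fintype.ofFinite G
  have hd : orderOf x ∣ Fintype.card (zpowers x) := by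
    rw [← Nat.card_eq_fintype_card, Nat.card_zpowers]
  rw [← IsCyclic.card_orderOf_eq_totient (α := zpowers x) hd, ← Fintype.card_subtype,
    ← Nat.card_eq_fintype_card]
  refine Nat.card_congr ⟨fun y => ⟨⟨y.1, y.2.1⟩, ?_⟩, fun y => ⟨y.1.1, ?_⟩,
    fun _ => rfl, fun _ => rfl⟩
  · simpa using (mem_zpowers_and_mem_zpowers_iff.1 y.2).2
  · exact mem_zpowers_and_mem_zpowers_iff.2 ⟨y.1.2, by simpa using y.2⟩

theorem GeneratesMaximalCyclic.overCard_eq [Finite G] {y : G} (hy : GeneratesMaximalCyclic y) :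
    overCard y = (orderOf y).totient := by
  rw [← card_generators_zpowers y]
  exact Nat.card_congr (Equiv.subtypeEquivRight fun z => ⟨fun h => ⟨hy z h, h⟩, fun h => h.2⟩)

theorem totient_orderOf_le_overCard [Finite G] (x : G) : (orderOf x).totient ≤ overCard x := by
  rw [← card_generators_zpowers x]
  exact Nat.card_le_card_of_injective
    (fun y : {y : G // y ∈ zpowers x ∧ x ∈ zpowers y} => (⟨y.1, y.2.2⟩ : {y : G // x ∈ zpowers y}))
    fun a b h => Subtype.ext (by simpa using h)

theorem overCard_one : overCard (1 : G) = Nat.card G := by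
  unfold overCard
  exact Nat.card_congr (Equiv.subtypeUnivEquiv fun y => one_mem _)

theorem overCard_mulEquiv {H : Type*} [Group H] (e : G ≃* H) (x : G) :
    overCard (e x) = overCard x := by
  refine (Nat.card_congr (e.toEquiv.subtypeEquiv fun y => ?_)).symm
  change x ∈ zpowers y ↔ e x ∈ zpowers (e y)
  simp only [mem_zpowers_iff, ← map_zpow, e.injective.eq_iff]

theorem generatesMaximalCyclic_mulEquiv {H : Type*} [Group H] (e : G ≃* H) {x : G} :
    GeneratesMaximalCyclic (e x) ↔ GeneratesMaximalCyclic x := by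
  have key : ∀ a b : G, e a ∈ zpowers (e b) ↔ a ∈ zpowers b := fun a b => by
    simp only [mem_zpowers_iff, ← map_zpow, e.injective.eq_iff]
  unfold GeneratesMaximalCyclic
  rw [← e.toEquiv.forall_congr_right]
  exact forall_congr' fun z => imp_congr (key _ _) (key _ _)

theorem exists_pos_pow_iff_mem_zpowers [Finite G] {x y : G} :
    (∃ m : ℕ, 0 < m ∧ y = x ^ m) ↔ y ∈ zpowers x := by
  constructor
  · rintro ⟨m, -, rfl⟩
    exact npow_mem_zpowers x m
  · intro h
    obtain ⟨m, rfl⟩ := mem_powers_iff_mem_zpowers.2 h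
    exact ⟨m + orderOf x, by have := orderOf_pos x; omega, by simp [pow_add]⟩

theorem powerGraph_adj_iff [Finite G] {x y : G} :
    (powerGraph G).Adj x y ↔ x ≠ y ∧ (y ∈ zpowers x ∨ x ∈ zpowers y) := by
  simp only [powerGraph, SimpleGraph.fromRel_adj, exists_pos_pow_iff_mem_zpowers]

/-- Inclusion-exclusion on the closed neighbourhood; the 1 counts x itself, and the totient counts
the overlap. -/
theorem powerGraph_degree [Fintype G] [DecidableRel (powerGraph G).Adj] (x : G) :
    (powerGraph G).degree x + 1 + (orderOf x).totient = orderOf x + overCard x := by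
  classical
  have hins : insert x ((powerGraph G).neighborFinset x) =
      Finset.univ.filter (· ∈ zpowers x) ∪ Finset.univ.filter (x ∈ zpowers ·) := by
    ext y
    by_cases hxy : y = x
    · simp [hxy]
    · simp [powerGraph_adj_iff, hxy, Ne.symm hxy]
  have hcard : ∀ q : G → Prop, Nat.card {y : G // q y} = (Finset.univ.filter q).card := fun q => by
    rw [Nat.card_eq_fintype_card, Fintype.card_subtype]
  have hdeg : (powerGraph G).degree x + 1 =
      (insert x ((powerGraph G).neighborFinset x)).card := by
    rw [Finset.card_insert_of_notMem (by simp), SimpleGraph.card_neighborFinset_eq_degree]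
  have hx : orderOf x = (Finset.univ.filter (· ∈ zpowers x)).card := by
    rw [← hcard, ← Nat.card_zpowers]
  rw [hdeg, hins, ← card_generators_zpowers x, overCard, hcard, hcard]
  rw [hx, ← Finset.card_union_add_card_inter {y | y ∈ zpowers x}]
  congr 2
  ext y
  simp

end Basic

/-! ### Products of groups of pairwise coprime orders. -/

section Pi

variable {ι : Type*} {P : ι → Type*} [∀ i, Group (P i)]

theorem apply_mem_zpowers {x y : ∀ i, P i} (h : x ∈ zpowers y) (i : ι) :
    x i ∈ zpowers (y i) := by
  obtain ⟨m, rfl⟩ := mem_zpowers_iff.1 h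
  exact zpow_mem_zpowers (y i) m

variable [Fintype ι]

/-- The Chinese remainder theorem merges the exponents of the components into one. This is what
makes all local quantities multiplicative. -/
theorem mem_zpowers_pi_iff [∀ i, Finite (P i)]
    (hco : Pairwise fun i j => (Nat.card (P i)).Coprime (Nat.card (P j))) {x y : ∀ i, P i} :
    x ∈ zpowers y ↔ ∀ i, x i ∈ zpowers (y i) := by
  refine ⟨apply_mem_zpowers, fun h => ?_⟩
  choose m hm using fun i => mem_powers_iff_mem_zpowers.2 (h i)
  let k := Nat.chineseRemainderOfFinset m (fun i => orderOf (y i)) Finset.univ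
    (fun i _ => (orderOf_pos (y i)).ne')
    (fun i _ j _ hij => (hco hij).of_dvd (orderOf_dvd_natCard _) (orderOf_dvd_natCard _))
  refine mem_powers_iff_mem_zpowers.1 ⟨k.1, funext fun i => ?_⟩
  rw [← hm i]
  exact pow_eq_pow_iff_modEq.2 (k.2 i (Finset.mem_univ i))

variable [∀ i, Finite (P i)]
  (hco : Pairwise fun i j => (Nat.card (P i)).Coprime (Nat.card (P j)))
include hco

theorem overCard_pi (x : ∀ i, P i) : overCard x = ∏ i, overCard (x i) := by
  unfold overCard
  rw [← Nat.card_pi]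
  refine Nat.card_congr (Equiv.trans (Equiv.subtypeEquivRight fun y => mem_zpowers_pi_iff hco) ?_)
  exact Equiv.subtypePiEquivPi (p := fun i (y : P i) => x i ∈ zpowers y)

theorem orderOf_pi_eq_prod (x : ∀ i, P i) : orderOf x = ∏ i, orderOf (x i) := by
  simp only [← Nat.card_zpowers]
  rw [← Nat.card_pi]
  exact Nat.card_congr (Equiv.trans (Equiv.subtypeEquivRight fun y => mem_zpowers_pi_iff hco)
    Equiv.subtypePiEquivPi)

theorem totient_orderOf_pi (x : ∀ i, P i) :
    (orderOf x).totient = ∏ i, (orderOf (x i)).totient := by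
  simp only [← card_generators_zpowers]
  rw [← Nat.card_pi]
  refine Nat.card_congr (Equiv.trans (Equiv.subtypeEquivRight fun y => ?_) Equiv.subtypePiEquivPi)
  rw [mem_zpowers_pi_iff hco, mem_zpowers_pi_iff hco, forall_and]

theorem generatesMaximalCyclic_pi_iff {y : ∀ i, P i} :
    GeneratesMaximalCyclic y ↔ ∀ i, GeneratesMaximalCyclic (y i) := by
  classical
  constructor
  · intro h i z hz
    have := h (Function.update y i z) ((mem_zpowers_pi_iff hco).2 fun j => ?_)
    · simpa using apply_mem_zpowers this i
    · by_cases hj : j = i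
      · subst hj; simpa using hz
      · simp [hj]
  · intro h z hz
    exact (mem_zpowers_pi_iff hco).2 fun i => h i _ (apply_mem_zpowers hz i)

/-- The components of a generator of a maximal cyclic subgroup of minimum order generate maximal
cyclic subgroups of minimum order. -/
theorem orderOf_apply_le_of_minOrder {y : ∀ i, P i} (hy : GeneratesMaximalCyclic y)
    (hmin : ∀ z : ∀ i, P i, GeneratesMaximalCyclic z → orderOf y ≤ orderOf z) (i : ι) (w : P i)
    (hw : GeneratesMaximalCyclic w) : orderOf (y i) ≤ orderOf w := by
  classical
  have hz : GeneratesMaximalCyclic (Function.update y i w) := by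
    refine (generatesMaximalCyclic_pi_iff hco).2 fun j => ?_
    by_cases hj : j = i
    · subst hj; simpa using hw
    · simpa [hj] using (generatesMaximalCyclic_pi_iff hco).1 hy j
  have h := hmin _ hz
  rw [orderOf_pi_eq_prod hco, orderOf_pi_eq_prod hco, ← Finset.mul_prod_erase _ _ (Finset.mem_univ i),
    ← Finset.mul_prod_erase _ (fun j => orderOf (Function.update y i w j)) (Finset.mem_univ i)] at h
  have hrest : ∏ j ∈ Finset.univ.erase i, orderOf (Function.update y i w j) =
      ∏ j ∈ Finset.univ.erase i, orderOf (y j) :=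
    Finset.prod_congr rfl fun j hj => by simp [Finset.ne_of_mem_erase hj]
  rw [hrest, Function.update_self] at h
  exact Nat.le_of_mul_le_mul_right h (Finset.prod_pos fun j _ => orderOf_pos _)

end Pi

/-! ### Counting cyclic overgroups in a p-group. -/

section PGroup

variable {p : ℕ} [hp : Fact p.Prime]

/-- A finite abelian `p`-group with at most `p` elements killed by `p` is cyclic. -/
theorem IsPGroup.isCyclic_of_card_torsion_le {A : Type*} [Group A] [IsMulCommutative A]
    [Finite A] (hA : IsPGroup p A) (h : Nat.card {a : A // a ^ p = 1} ≤ p) : IsCyclic A := by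
  classical
  have := Fintype.ofFinite A
  have hcard : ∀ q : A → Prop, Nat.card {y : A // q y} = (Finset.univ.filter q).card := fun q => by
    rw [Nat.card_eq_fintype_card, Fintype.card_subtype]
  rw [hcard] at h
  have key : ∀ j : ℕ, (Finset.univ.filter fun a : A => a ^ p ^ j = 1).card ≤ p ^ j := by
    intro j
    induction j with
    | zero => simpa using Finset.card_le_one.2 (by simp)
    | succ j ih =>
      rw [pow_succ']
      refine le_trans ?_ (Nat.mul_le_mul_left p ih)
      -- The p-th power map sends p^(j+1)-torsion to p^j-torsion, and each nonempty fibre injects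
      -- into the p-torsion.
      refine Finset.card_le_mul_card_image_of_maps_to (f := fun a : A => a ^ p) ?_ p ?_
      · intro a ha
        simpa [← pow_mul] using ha
      · intro b _
        refine le_trans ?_ h
        rcases Finset.eq_empty_or_nonempty
          ((Finset.univ.filter fun a : A => a ^ (p * p ^ j) = 1).filter fun a => a ^ p = b) with
          h0 | ⟨c, hc⟩
        · simp [h0]
        · have hc : c ^ p = b := (Finset.mem_filter.1 hc).2
          refine Finset.card_le_card_of_injOn (fun a => a / c) (fun a ha => ?_)
            (fun a _ b _ hab => div_left_injective hab)
          have ha : a ^ p = b := (Finset.mem_filter.1 ha).2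
          have hcomm : Commute a c := mul_comm' a c
          simp [div_eq_mul_inv, hcomm.inv_right.mul_pow, ha, hc]
  refine isCyclic_of_card_pow_eq_one_le fun n hn => ?_
  -- Only gcd(n, |A|), a power of p, matters for n-torsion.
  obtain ⟨k, hk⟩ := hA.exists_card_eq
  obtain ⟨j, -, hj⟩ := (Nat.dvd_prime_pow hp.out).1 (hk ▸ Nat.gcd_dvd_right n (Nat.card A))
  refine le_trans (Finset.card_le_card ?_) ((key j).trans (hj ▸ Nat.gcd_le_left _ hn))
  intro a ha
  simp only [Finset.mem_filter, Finset.mem_univ, true_and] at ha ⊢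
  rw [← hj]
  exact pow_gcd_eq_one.2 ⟨ha, hk ▸ pow_card_eq_one'⟩

variable {P : Type*} [Group P] [Finite P] (hP : IsPGroup p P)
include hP

/-- Otherwise the p-torsion of the center would embed in that of the cyclic group ⟨w⟩, which has at
most p elements, and the center would be cyclic. -/
theorem IsPGroup.exists_central_notMem_zpowers (hZ : ¬ IsCyclic (center P)) (w : P) :
    ∃ z ∈ center P, z ^ p = 1 ∧ z ∉ zpowers w := by
  classical
  by_contra! hcon
  refine hZ ((hP.to_subgroup (center P)).isCyclic_of_card_torsion_le ?_)
  have := Fintype.ofFinite P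
  refine le_trans ?_ (IsCyclic.card_pow_eq_one_le (α := zpowers w) hp.out.pos)
  rw [← Fintype.card_subtype, ← Nat.card_eq_fintype_card]
  have hz (z : {z : center P // z ^ p = 1}) : (z.1 : P) ^ p = 1 := by
    exact_mod_cast congrArg Subtype.val z.2
  refine Nat.card_le_card_of_injective
    (fun z => ⟨⟨z.1.1, hcon z.1.1 z.1.2 (hz z)⟩, Subtype.ext (hz z)⟩) fun a b hab => ?_
  exact Subtype.ext (Subtype.ext (congrArg (fun c => (c.1 : P)) hab))

/-- In a cyclic `p`-group, the elements whose cyclic subgroup misses `x` lie in the subgroup of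
index `p` of `⟨x⟩`. -/
theorem IsPGroup.card_le_overCard_add [IsCyclic P] {x : P} (hx : x ≠ 1) :
    Nat.card P ≤ overCard x + orderOf x / p := by
  classical
  have := Fintype.ofFinite P
  obtain ⟨g, hg⟩ := IsCyclic.exists_generator (α := P)
  obtain ⟨k, hk⟩ := IsPGroup.iff_orderOf.1 hP x
  obtain ⟨k, rfl⟩ : ∃ m, k = m + 1 := Nat.exists_eq_succ_of_ne_zero fun h0 =>
    hx (orderOf_eq_one_iff.1 (by rw [hk, h0, pow_zero]))
  have hdiv : orderOf x / p = p ^ k := by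
    rw [hk, pow_succ, Nat.mul_div_cancel _ hp.out.pos]
  rw [hdiv]
  have hle := IsCyclic.card_pow_eq_one_le (α := P) (pow_pos hp.out.pos k)
  rw [overCard, Nat.card_eq_fintype_card, Nat.card_eq_fintype_card, Fintype.card_subtype,
    ← Finset.card_univ, ← Finset.card_filter_add_card_filter_not (fun y : P => x ∈ zpowers y)]
  -- In a cyclic p-group, failing to reach x means having order at most p^k.
  refine Nat.add_le_add_left (le_trans (Finset.card_le_card fun y hy => ?_) hle) _
  simp only [Finset.mem_filter, Finset.mem_univ, true_and] at hy ⊢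
  obtain ⟨l, hl⟩ := IsPGroup.iff_orderOf.1 hP y
  rw [mem_zpowers_iff_orderOf_dvd (hg x) (hg y), hk, hl,
    Nat.pow_dvd_pow_iff_le_right hp.out.one_lt] at hy
  rw [← orderOf_dvd_iff_pow_eq_one, hl]
  exact pow_dvd_pow p (by omega)

/-- In a `p`-group with noncyclic center, multiplying by a central subgroup of order `p` produces
many elements whose cyclic subgroup contains `x`. -/
theorem IsPGroup.totient_add_le_overCard (hZ : ¬ IsCyclic (center P)) {x w : P}
    (hx : x ∈ zpowers w) :
    (orderOf x).totient + p * (orderOf w - orderOf x) ≤ overCard x := by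
  classical
  have := Fintype.ofFinite P
  obtain ⟨z, hzc, hzp, hzw⟩ := hP.exists_central_notMem_zpowers hZ w
  have hzo : orderOf z = p := orderOf_eq_prime hzp fun h => hzw (h ▸ one_mem _)
  -- ⟨z⟩ has prime order and is not inside ⟨w⟩, so the two meet trivially. This makes the products c
  -- * s below distinct, and different from the generators of ⟨x⟩.
  have hzpow : ∀ c ∈ zpowers z, c ∈ zpowers w → c = 1 := by
    intro c hc hcw
    by_contra hc1
    refine hzw (zpowers_le.2 hcw ((mem_zpowers_iff_orderOf_dvd (mem_zpowers z) hc).2 ?_))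
    have := orderOf_dvd_of_mem_zpowers hc
    rw [hzo] at this ⊢
    rcases (Nat.dvd_prime hp.out).1 this with h1 | h1
    · exact absurd (orderOf_eq_one_iff.1 h1) hc1
    · exact h1.symm.dvd
  have hxw : zpowers x ≤ zpowers w := zpowers_le.2 hx
  let S : Finset P := Finset.univ.filter fun y => y ∈ zpowers w ∧ y ∉ zpowers x
  let Z : Finset P := Finset.univ.filter (· ∈ zpowers z)
  let Gx : Finset P := Finset.univ.filter fun y => y ∈ zpowers x ∧ x ∈ zpowers y
  have hcard (q : P → Prop) : Nat.card {y : P // q y} = (Finset.univ.filter q).card := by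
    rw [Nat.card_eq_fintype_card, Fintype.card_subtype]
  have hcz (v : P) : (Finset.univ.filter (· ∈ zpowers v)).card = orderOf v := by
    rw [← hcard, ← Nat.card_zpowers]
  have hS : S.card = orderOf w - orderOf x := by
    rw [← hcz w, ← hcz x, ← Finset.card_sdiff_of_subset]
    · congr 1
      ext y
      simp [S]
    · intro y hy
      simp only [Finset.mem_filter, Finset.mem_univ, true_and] at hy ⊢
      exact hxw hy
  have hinj : Set.InjOn (fun a : P × P => a.1 * a.2) (Z ×ˢ S : Finset (P × P)) := by
    rintro ⟨c, s⟩ hcs ⟨d, t⟩ hdt heq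
    simp only [Finset.coe_product, Set.mem_prod, Finset.mem_coe, Finset.mem_filter,
      Finset.mem_univ, true_and, Z, S] at hcs hdt heq
    have h1 : d⁻¹ * c = t * s⁻¹ := by
      rw [inv_mul_eq_iff_eq_mul, ← mul_assoc, ← heq, mul_inv_cancel_right]
    have h2 := hzpow (d⁻¹ * c) (mul_mem (inv_mem hdt.1) hcs.1)
      (h1 ▸ mul_mem hdt.2.1 (inv_mem hcs.2.1))
    have h3 : d = c := inv_mul_eq_one.1 h2
    subst h3
    simpa using heq
  have hdisj : Disjoint Gx ((Z ×ˢ S).image fun a : P × P => a.1 * a.2) := by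
    rw [Finset.disjoint_left]
    intro y hy hy'
    simp only [Finset.mem_image, Finset.mem_product, Finset.mem_filter, Finset.mem_univ, true_and,
      Z, S, Gx, Prod.exists] at hy hy'
    obtain ⟨c, s, ⟨hc, hsw, hsx⟩, rfl⟩ := hy'
    have h1 := hzpow c hc ((mul_mem_cancel_right hsw).1 (hxw hy.1))
    rw [h1, one_mul] at hy
    exact hsx hy.1
  have hsub : Gx ∪ ((Z ×ˢ S).image fun a : P × P => a.1 * a.2) ⊆
      Finset.univ.filter (x ∈ zpowers ·) := by
    intro y hy
    simp only [Finset.mem_union, Finset.mem_image, Finset.mem_product, Finset.mem_filter,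
      Finset.mem_univ, true_and, Z, S, Gx, Prod.exists] at hy ⊢
    rcases hy with hy | ⟨c, s, ⟨hc, hsw, hsx⟩, rfl⟩
    · exact hy.2
    · have hcc : c ∈ center P := zpowers_le.2 hzc hc
      have hcp : c ^ p = 1 := by
        rw [← orderOf_dvd_iff_pow_eq_one, ← hzo]
        exact orderOf_dvd_of_mem_zpowers hc
      -- The central factor vanishes in the p-th power; s has order at least p times that of x, so s
      -- ^ p still reaches x.
      have hpow : (c * s) ^ p = s ^ p := by
        rw [(show Commute c s from (mem_center_iff.1 hcc s).symm).mul_pow, hcp, one_mul]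
      have hxs : x ∈ zpowers (s ^ p) := by
        rw [mem_zpowers_iff_orderOf_dvd hx (pow_mem hsw p)]
        rw [mem_zpowers_iff_orderOf_dvd hsw hx] at hsx
        obtain ⟨k, hk⟩ := IsPGroup.iff_orderOf.1 hP x
        obtain ⟨l, hl⟩ := IsPGroup.iff_orderOf.1 hP s
        rw [hk, hl, Nat.pow_dvd_pow_iff_le_right hp.out.one_lt] at hsx
        obtain ⟨l, rfl⟩ : ∃ m, l = m + 1 := ⟨l - 1, by omega⟩
        rw [orderOf_pow, hl, pow_succ, Nat.gcd_mul_left_left, Nat.mul_div_cancel _ hp.out.pos, hk]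
        exact pow_dvd_pow p (by omega)
      rw [← hpow] at hxs
      exact zpowers_le.2 (npow_mem_zpowers (c * s) p) hxs
  calc (orderOf x).totient + p * (orderOf w - orderOf x)
      = (Gx ∪ ((Z ×ˢ S).image fun a : P × P => a.1 * a.2)).card := by
        rw [Finset.card_union_of_disjoint hdisj, Finset.card_image_of_injOn hinj,
          Finset.card_product, hS, hcz z, hzo, ← card_generators_zpowers x, hcard]
        congr!
    _ ≤ overCard x := by
        rw [overCard, hcard]
        exact Finset.card_le_card hsub

end PGroup

/-! ### Real inequalities for the local factors. -/

section Inequalities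

open Finset

variable {ι : Type*} {p a m f N : ι → ℝ}

theorem prod_le_two_mul_prod_mul {T : Finset ι} {t : ι → ℝ} (hm : ∀ i, 0 < m i)
    (hT : 1 ≤ 2 * ∏ i ∈ T, t i) : ∏ i ∈ T, m i ≤ 2 * ∏ i ∈ T, m i * t i := by
  have : 0 < ∏ i ∈ T, m i := prod_pos fun i _ => hm i
  rw [prod_mul_distrib]
  nlinarith

theorem sub_one_div_mem_Icc {x : ℝ} (hx : 2 ≤ x) : 0 ≤ 1 - 1 / x ∧ 1 - 1 / x ≤ 1 := by
  have h1 : 0 < 1 / x := by positivity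
  have h2 : 1 / x ≤ 1 := by rw [div_le_one (by linarith)]; linarith
  constructor <;> linarith

/-- With x = p, b = a, c = m, e = f: orders of p-elements drop by a factor of at least p, whence N ≥
(p - 1)m. -/
theorem sub_one_mul_le_of_mul_le {x b c e n : ℝ} (hc : 0 ≤ e) (hxb : x * b ≤ c)
    (hn : e + x * (c - b) ≤ n) : (x - 1) * c ≤ n := by
  nlinarith

variable [Fintype ι] [DecidableEq ι]

/-- The degree bound when every Sylow subgroup is noncyclic. Here `a`, `f`, `N` stand for the
orders of the components of an element, their totients, and the numbers of elements above them,
while `m` stands for the minimum orders of maximal cyclic subgroups. -/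
theorem prod_le_of_forall_noncyclic (hp : ∀ i, p i = 2 ∨ 3 ≤ p i)
    (hpinj : Function.Injective p) (hm : ∀ i, 0 < m i)
    (hf0 : ∀ i, 0 ≤ f i) (hfa : ∀ i, f i ≤ a i) (hfN : ∀ i, f i ≤ N i)
    (hbig : ∀ i, m i ≤ a i → f i = a i * (1 - 1 / p i))
    (hsmall : ∀ i, a i < m i → p i * a i ≤ m i ∧ f i + p i * (m i - a i) ≤ N i)
    (hT : ∀ l, 1 ≤ 2 * ∏ i ∈ univ.erase l, (1 - 1 / p i)) :
    ∏ i, m i ≤ ∏ i, a i - ∏ i, f i + ∏ i, N i := by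
  have hp2 : ∀ i, 2 ≤ p i := fun i => by rcases hp i with h | h <;> linarith
  have ht : ∀ i, 0 ≤ 1 - 1 / p i ∧ 1 - 1 / p i ≤ 1 := fun i => sub_one_div_mem_Icc (hp2 i)
  have hmN : ∀ i, m i * (1 - 1 / p i) ≤ N i := by
    intro i
    rcases lt_or_ge (a i) (m i) with h | h
    · have := sub_one_mul_le_of_mul_le (hf0 i) (hsmall i h).1 (hsmall i h).2
      nlinarith [hp2 i, hm i, ht i]
    · exact (mul_le_mul_of_nonneg_right h (ht i).1).trans ((hbig i h).symm.le.trans (hfN i))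
  have hfaprod : ∏ i, f i ≤ ∏ i, a i := prod_le_prod (fun i _ => hf0 i) fun i _ => hfa i
  have hfNprod : ∏ i, f i ≤ ∏ i, N i := prod_le_prod (fun i _ => hf0 i) fun i _ => hfN i
  -- A component with a < m at an odd prime has N ≥ 2m, which offsets the loss of at most 1/2
  -- elsewhere; ∏ N alone suffices.
  by_cases hodd : ∃ l, a l < m l ∧ 3 ≤ p l
  · obtain ⟨l, hl, hl3⟩ := hodd
    have h1 := sub_one_mul_le_of_mul_le (hf0 l) (hsmall l hl).1 (hsmall l hl).2
    have h2 : 2 * m l ≤ N l := by nlinarith [hm l]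
    have h3 : ∏ i ∈ univ.erase l, m i * (1 - 1 / p i) ≤ ∏ i ∈ univ.erase l, N i :=
      prod_le_prod (fun i _ => mul_nonneg (hm i).le (ht i).1) fun i _ => hmN i
    have h4 := prod_le_two_mul_prod_mul hm (hT l)
    have h5 : 0 ≤ ∏ i ∈ univ.erase l, m i * (1 - 1 / p i) :=
      prod_nonneg fun i _ => mul_nonneg (hm i).le (ht i).1
    have h6 : ∏ i, m i ≤ ∏ i, N i := by
      rw [← mul_prod_erase _ m (mem_univ l), ← mul_prod_erase _ N (mem_univ l)]
      calc m l * ∏ i ∈ univ.erase l, m i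
          ≤ m l * (2 * ∏ i ∈ univ.erase l, m i * (1 - 1 / p i)) :=
            mul_le_mul_of_nonneg_left h4 (hm l).le
        _ = 2 * m l * ∏ i ∈ univ.erase l, m i * (1 - 1 / p i) := by ring
        _ ≤ N l * ∏ i ∈ univ.erase l, N i :=
            mul_le_mul h2 h3 h5 (by linarith [hm l])
    linarith
  by_cases hex : ∃ l, a l < m l
  · obtain ⟨l, hl⟩ := hex
    -- Every index with a < m now has prime 2, and the primes are distinct.
    have hothers : ∀ i ∈ univ.erase l, m i ≤ a i := by
      intro i hi
      by_contra! hlt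
      have h2 : ∀ j, a j < m j → p j = 2 := fun j hj =>
        (hp j).resolve_right fun h3 => hodd ⟨j, hj, h3⟩
      exact ne_of_mem_erase hi (hpinj ((h2 i hlt).trans (h2 l hl).symm))
    rw [← mul_prod_erase _ m (mem_univ l), ← mul_prod_erase _ N (mem_univ l),
      ← mul_prod_erase _ a (mem_univ l), ← mul_prod_erase _ f (mem_univ l)]
    have hF : ∏ i ∈ univ.erase l, f i =
        (∏ i ∈ univ.erase l, a i) * ∏ i ∈ univ.erase l, (1 - 1 / p i) := by
      rw [← prod_mul_distrib]
      exact prod_congr rfl fun i hi => hbig i (hothers i hi)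
    have hN : ∏ i ∈ univ.erase l, f i ≤ ∏ i ∈ univ.erase l, N i :=
      prod_le_prod (fun i _ => hf0 i) fun i _ => hfN i
    have hA : ∏ i ∈ univ.erase l, m i ≤ ∏ i ∈ univ.erase l, a i :=
      prod_le_prod (fun i _ => (hm i).le) hothers
    have hA0 : 0 < ∏ i ∈ univ.erase l, m i := prod_pos fun i _ => hm i
    have hNl := (hsmall l hl).2
    have hT' := hT l
    rw [hF] at hN ⊢
    generalize ∏ i ∈ univ.erase l, a i = A at *
    generalize ∏ i ∈ univ.erase l, (1 - 1 / p i) = b at *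
    have hb : 0 < b := by linarith
    have hAb : 0 < A * b := mul_pos (hA0.trans_le hA) hb
    have h1 : N l * (A * b) ≤ N l * ∏ i ∈ univ.erase l, N i :=
      mul_le_mul_of_nonneg_left hN ((hf0 l).trans (hfN l))
    have h2 : (f l + p l * (m l - a l)) * (A * b) ≤ N l * (A * b) :=
      mul_le_mul_of_nonneg_right hNl hAb.le
    -- The terms in f l cancel; the surplus p l * (m l - a l) * A * b is enough because p l ≥ 2 and
    -- b ≥ 1/2.
    have h3 : 1 ≤ p l * b := by nlinarith [hp2 l]
    have h4 : (m l - a l) * A * 1 ≤ (m l - a l) * A * (p l * b) :=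
      mul_le_mul_of_nonneg_left h3 (mul_nonneg (by linarith) (hA0.trans_le hA).le)
    have h5 : m l * ∏ i ∈ univ.erase l, m i ≤ m l * A := mul_le_mul_of_nonneg_left hA (hm l).le
    linarith
  · push Not at hex
    have : ∏ i, m i ≤ ∏ i, a i := prod_le_prod (fun i _ => (hm i).le) fun i _ => hex i
    linarith

/-- The degree bound when some Sylow subgroup is cyclic, with the notation of
`prod_le_of_forall_noncyclic`; `J` is the set of indices of noncyclic Sylow subgroups. -/
theorem exists_prod_erase_le {J : Finset ι} (hJ : J ≠ univ)
    (hp : ∀ i, 3 ≤ p i) (hpsep : ∀ i j, i ≠ j → p i + 1 ≤ p j ∨ p j + 1 ≤ p i)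
    (hm : ∀ i, 0 < m i) (ha : ∀ i, 1 ≤ a i)
    (hf0 : ∀ i, 0 ≤ f i) (hfa : ∀ i, f i ≤ a i) (hfN : ∀ i, f i ≤ N i)
    (hbig : ∀ i, m i ≤ a i → f i = a i * (1 - 1 / p i))
    (hsmall : ∀ i, a i < m i → p i * a i ≤ m i)
    (hnc : ∀ i ∈ J, a i < m i → f i + p i * (m i - a i) ≤ N i)
    (hcyc : ∀ i ∉ J, m i - a i + f i ≤ N i ∧ m i - a i / p i ≤ N i)
    (hle : ∀ i ∉ J, a i ≤ m i)
    (hT : 1 ≤ 2 * ∏ i, (1 - 1 / p i)) :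
    ∃ c ∉ J, ∏ i ∈ univ.erase c, m i + (m c - 1) * ∏ i ∈ univ.erase c, m i * (1 - 1 / p i) ≤
      ∏ i, a i - ∏ i, f i + ∏ i, N i := by
  have ht : ∀ i, 0 ≤ 1 - 1 / p i ∧ 1 - 1 / p i ≤ 1 := fun i =>
    sub_one_div_mem_Icc (by linarith [hp i])
  have hp0 : ∀ i, 0 < p i := fun i => by linarith [hp i]
  have hmN : ∀ i, m i * (1 - 1 / p i) ≤ N i := by
    intro i
    by_cases hi : i ∈ J
    · rcases lt_or_ge (a i) (m i) with h | h
      · have := sub_one_mul_le_of_mul_le (hf0 i) (hsmall i h) (hnc i hi h)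
        nlinarith [hp i, hm i, ht i]
      · exact (mul_le_mul_of_nonneg_right h (ht i).1).trans ((hbig i h).symm.le.trans (hfN i))
    · have h1 : a i / p i ≤ m i / p i := div_le_div_of_nonneg_right (hle i hi) (hp0 i).le
      have h2 : m i * (1 - 1 / p i) = m i - m i / p i := by ring
      linarith [(hcyc i hi).2]
  have hfaprod : ∏ i, f i ≤ ∏ i, a i := prod_le_prod (fun i _ => hf0 i) fun i _ => hfa i
  have hmt : ∀ i, 0 ≤ m i * (1 - 1 / p i) := fun i => mul_nonneg (hm i).le (ht i).1
  obtain ⟨c₀, hc₀⟩ : ∃ c, c ∉ J := by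
    by_contra! h
    exact hJ (eq_univ_iff_forall.2 h)
  -- A noncyclic component with a < m brings ∏ N up to ∏ m, which dominates the target for any c
  -- outside J.
  by_cases hcase : ∃ l ∈ J, a l < m l
  · obtain ⟨l, hlJ, hl⟩ := hcase
    have h1 := sub_one_mul_le_of_mul_le (hf0 l) (hsmall l hl) (hnc l hlJ hl)
    have h2 : 2 * (m l * (1 - 1 / p l)) ≤ N l := by nlinarith [hm l, hp l, ht l]
    have h3 : ∏ i ∈ univ.erase l, m i * (1 - 1 / p i) ≤ ∏ i ∈ univ.erase l, N i :=
      prod_le_prod (fun i _ => hmt i) fun i _ => hmN i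
    have h4 := prod_le_two_mul_prod_mul hm hT
    have h5 : 0 ≤ ∏ i ∈ univ.erase l, m i * (1 - 1 / p i) := prod_nonneg fun i _ => hmt i
    have h6 : ∏ i, m i ≤ ∏ i, N i := by
      refine h4.trans ?_
      rw [← mul_prod_erase _ N (mem_univ l),
        ← mul_prod_erase _ (fun i => m i * (1 - 1 / p i)) (mem_univ l), ← mul_assoc]
      exact mul_le_mul h2 h3 h5 (by linarith [hmt l])
    refine ⟨c₀, hc₀, ?_⟩
    have h7 : ∏ i ∈ univ.erase c₀, m i * (1 - 1 / p i) ≤ ∏ i ∈ univ.erase c₀, m i :=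
      prod_le_prod (fun i _ => hmt i) fun i _ => mul_le_of_le_one_right (hm i).le (ht i).2
    have h8 : 1 ≤ m c₀ := (ha c₀).trans (hle c₀ hc₀)
    have h9 := mul_le_mul_of_nonneg_left h7 (sub_nonneg.2 h8)
    rw [← mul_prod_erase _ m (mem_univ c₀)] at h6
    linarith
  push Not at hcase
  -- With two cyclic components below m, the index to delete is the one with the larger prime.
  by_cases hpair : ∃ c ∉ J, ∃ e ∉ J, a c < m c ∧ a e < m e ∧ p e + 1 ≤ p c
  · obtain ⟨c, hc, e, he, hac, hae, hpe⟩ := hpair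
    refine ⟨c, hc, ?_⟩
    have hce : e ∈ univ.erase c := mem_erase.2 ⟨fun h => by subst h; linarith, mem_univ e⟩
    have hdiv : ∀ i ∉ J, a i < m i → m i * ((1 - 1 / p i) * (1 + 1 / p i)) ≤ N i := by
      intro i hi hlt
      have h1 : a i / p i ≤ m i * (1 / p i * (1 / p i)) := by
        have h := hsmall i hlt
        rw [div_le_iff₀ (hp0 i)]
        have h' : m i * (1 / p i * (1 / p i)) * p i = m i / p i := by
          field_simp [(hp0 i).ne']
        rw [h', le_div_iff₀ (hp0 i)]
        linarith
      have h2 : m i * ((1 - 1 / p i) * (1 + 1 / p i)) = m i - m i * (1 / p i * (1 / p i)) := by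
        ring
      linarith [(hcyc i hi).2]
    have hNc := hdiv c hc hac
    have hNe := hdiv e he hae
    rw [← mul_prod_erase _ N (mem_univ c), ← mul_prod_erase _ N hce,
      ← mul_prod_erase _ (fun i => m i * (1 - 1 / p i)) hce, ← mul_prod_erase _ m hce]
    have hR : ∏ i ∈ (univ.erase c).erase e, m i * (1 - 1 / p i) ≤
        ∏ i ∈ (univ.erase c).erase e, N i := prod_le_prod (fun i _ => hmt i) fun i _ => hmN i
    have hM0 : 0 < ∏ i ∈ (univ.erase c).erase e, m i := prod_pos fun i _ => hm i
    rw [← mul_prod_erase _ _ (mem_univ c), ← mul_prod_erase _ _ hce] at hT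
    have hR0 : 0 ≤ ∏ i ∈ (univ.erase c).erase e, (1 - 1 / p i) := prod_nonneg fun i _ => (ht i).1
    rw [prod_mul_distrib] at hR ⊢
    generalize ∏ i ∈ (univ.erase c).erase e, m i = M at *
    generalize ∏ i ∈ (univ.erase c).erase e, (1 - 1 / p i) = R at *
    generalize ∏ i ∈ (univ.erase c).erase e, N i = K at *
    have hpc : p c ≤ m c := by nlinarith [hsmall c hac, ha c, hp0 c]
    -- 1 + 1 / (p c - 1) is the exact inverse of 1 - 1 / p c, and p e ≤ p c - 1.
    have hkey : 1 ≤ (1 - 1 / p c) * (1 + 1 / p e) := by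
      have h1 : 1 / (p c - 1) ≤ 1 / p e := one_div_le_one_div_of_le (hp0 e) (by linarith)
      have h2 : (1 - 1 / p c) * (1 + 1 / (p c - 1)) = 1 := by
        have : p c - 1 ≠ 0 := by linarith [hp c]
        have := (hp0 c).ne'
        field_simp
        ring
      nlinarith [(ht c).1]
    have hX0 : 0 ≤ (1 - 1 / p e) * R := mul_nonneg (ht e).1 hR0
    have hX : 1 ≤ 2 * ((1 - 1 / p e) * R) := by nlinarith [(ht c).2]
    have hprod : m c * ((1 - 1 / p c) * (1 + 1 / p c)) *
        (m e * ((1 - 1 / p e) * (1 + 1 / p e)) * (M * R)) ≤ N c * (N e * K) := by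
      have hpos : ∀ i, 0 ≤ m i * ((1 - 1 / p i) * (1 + 1 / p i)) := fun i =>
        mul_nonneg (hm i).le (mul_nonneg (ht i).1 (by have := hp0 i; positivity))
      have hMR : 0 ≤ M * R := mul_nonneg hM0.le hR0
      exact mul_le_mul hNc (mul_le_mul hNe hR hMR ((hpos e).trans hNe))
        (mul_nonneg (hpos e) hMR) ((hpos c).trans hNc)
    have hfin : m e * M + (m c - 1) * (m e * (1 - 1 / p e) * (M * R)) ≤
        m c * ((1 - 1 / p c) * (1 + 1 / p c)) *
          (m e * ((1 - 1 / p e) * (1 + 1 / p e)) * (M * R)) := by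
      have e1 : m c * ((1 - 1 / p c) * (1 + 1 / p c)) *
          (m e * ((1 - 1 / p e) * (1 + 1 / p e)) * (M * R)) =
          m e * M * (((1 - 1 / p c) * (1 + 1 / p e)) *
            (m c * (1 + 1 / p c) * ((1 - 1 / p e) * R))) := by ring
      have e2 : m e * M + (m c - 1) * (m e * (1 - 1 / p e) * (M * R)) =
          m e * M * (1 + (m c - 1) * ((1 - 1 / p e) * R)) := by ring
      rw [e1, e2]
      refine mul_le_mul_of_nonneg_left ?_ (mul_nonneg (hm e).le hM0.le)
      have h1 : 1 ≤ m c * (1 / p c) := by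
        rw [mul_one_div, le_div_iff₀ (hp0 c)]
        linarith
      have h2 : 0 ≤ m c * (1 + 1 / p c) * ((1 - 1 / p e) * R) :=
        mul_nonneg (mul_nonneg (hm c).le (by have := hp0 c; positivity)) hX0
      refine le_trans ?_ (le_mul_of_one_le_left h2 hkey)
      nlinarith [mul_le_mul_of_nonneg_right h1 hX0]
    linarith
  push Not at hpair
  -- At most one index with a < m is left, and it lies outside J.
  obtain ⟨c, hc, hothers⟩ : ∃ c ∉ J, ∀ i ∈ univ.erase c, m i ≤ a i := by
    by_cases hex : ∃ c ∉ J, a c < m c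
    · obtain ⟨c, hc, hac⟩ := hex
      refine ⟨c, hc, fun i hi => ?_⟩
      by_cases hiJ : i ∈ J
      · exact hcase i hiJ
      · by_contra! hlt
        have h1 := hpair c hc i hiJ hac hlt
        have h2 := hpair i hiJ c hc hlt hac
        rcases hpsep i c (ne_of_mem_erase hi) with h | h <;> linarith
    · push Not at hex
      refine ⟨c₀, hc₀, fun i _ => ?_⟩
      by_cases hiJ : i ∈ J
      · exact hcase i hiJ
      · exact hex i hiJ
  refine ⟨c, hc, ?_⟩
  rw [← mul_prod_erase _ N (mem_univ c), ← mul_prod_erase _ a (mem_univ c),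
    ← mul_prod_erase _ f (mem_univ c)]
  have hF : ∏ i ∈ univ.erase c, f i =
      (∏ i ∈ univ.erase c, a i) * ∏ i ∈ univ.erase c, (1 - 1 / p i) := by
    rw [← prod_mul_distrib]
    exact prod_congr rfl fun i hi => hbig i (hothers i hi)
  have hN : ∏ i ∈ univ.erase c, f i ≤ ∏ i ∈ univ.erase c, N i :=
    prod_le_prod (fun i _ => hf0 i) fun i _ => hfN i
  have hA : ∏ i ∈ univ.erase c, m i ≤ ∏ i ∈ univ.erase c, a i :=
    prod_le_prod (fun i _ => (hm i).le) hothers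
  have hA0 : 0 < ∏ i ∈ univ.erase c, m i := prod_pos fun i _ => hm i
  have hX0 : 0 ≤ ∏ i ∈ univ.erase c, (1 - 1 / p i) := prod_nonneg fun i _ => (ht i).1
  have hX1 : ∏ i ∈ univ.erase c, (1 - 1 / p i) ≤ 1 :=
    prod_le_one (fun i _ => (ht i).1) fun i _ => (ht i).2
  rw [hF] at hN ⊢
  rw [prod_mul_distrib]
  generalize ∏ i ∈ univ.erase c, a i = A at *
  generalize ∏ i ∈ univ.erase c, (1 - 1 / p i) = X at *
  generalize ∏ i ∈ univ.erase c, m i = M at *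
  have hAX : 0 ≤ A * X := mul_nonneg (hA0.le.trans hA) hX0
  have h1 : N c * (A * X) ≤ N c * ∏ i ∈ univ.erase c, N i :=
    mul_le_mul_of_nonneg_left hN ((hf0 c).trans (hfN c))
  have h2 : (m c - a c + f c) * (A * X) ≤ N c * (A * X) :=
    mul_le_mul_of_nonneg_right (hcyc c hc).1 hAX
  -- Since X ≤ 1, the expression a c + (m c - a c) * X is least at a c = 1, the value of the deleted
  -- component.
  have h3 : 0 ≤ (a c - 1) * (1 - X) :=
    mul_nonneg (sub_nonneg.2 (ha c)) (sub_nonneg.2 hX1)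
  have h4 : M * (1 + (m c - 1) * X) ≤ A * (1 + (m c - 1) * X) :=
    mul_le_mul_of_nonneg_right hA (by nlinarith [ha c, hle c hc])
  have h5 : A * (1 + (m c - 1) * X) ≤ A * (a c + (m c - a c) * X) :=
    mul_le_mul_of_nonneg_left (by linarith) (hA0.le.trans hA)
  linarith

end Inequalities

/-! ### Local estimates in the form the inequalities need. -/

section Components

variable {p : ℕ} [hp : Fact p.Prime] {P : Type*} [Group P]

theorem GeneratesMaximalCyclic.ne_one [Nontrivial P] {y : P} (hy : GeneratesMaximalCyclic y) :
    y ≠ 1 := by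
  rintro rfl
  obtain ⟨z, hz⟩ := exists_ne (1 : P)
  exact hz (by simpa using hy z (one_mem _))

theorem GeneratesMaximalCyclic.orderOf_eq_card [IsCyclic P] {y : P}
    (hy : GeneratesMaximalCyclic y) : orderOf y = Nat.card P := by
  obtain ⟨g, hg⟩ := IsCyclic.exists_generator (α := P)
  exact orderOf_eq_card_of_forall_mem_zpowers fun z => zpowers_le.2 (hy g (hg y)) (hg z)

variable (hP : IsPGroup p P)
include hP

theorem IsPGroup.exists_orderOf_eq_pow_succ {x : P} (hx : x ≠ 1) :
    ∃ k : ℕ, orderOf x = p ^ (k + 1) := by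
  obtain ⟨k, hk⟩ := IsPGroup.iff_orderOf.1 hP x
  obtain ⟨k, rfl⟩ : ∃ m, k = m + 1 := Nat.exists_eq_succ_of_ne_zero fun h0 =>
    hx (orderOf_eq_one_iff.1 (by rw [hk, h0, pow_zero]))
  exact ⟨k, hk⟩

theorem IsPGroup.totient_orderOf {x : P} (hx : x ≠ 1) :
    ((orderOf x).totient : ℝ) = orderOf x * (1 - 1 / (p : ℝ)) := by
  obtain ⟨k, hk⟩ := hP.exists_orderOf_eq_pow_succ hx
  have hp0 : (p : ℝ) ≠ 0 := by exact_mod_cast hp.out.ne_zero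
  rw [hk, Nat.totient_prime_pow_succ hp.out, Nat.cast_mul, Nat.cast_pow, Nat.cast_pow,
    Nat.cast_sub hp.out.one_le, Nat.cast_one]
  field_simp
  ring

theorem IsPGroup.mul_orderOf_le_of_lt {x y : P} (h : orderOf x < orderOf y) :
    p * orderOf x ≤ orderOf y := by
  obtain ⟨k, hk⟩ := IsPGroup.iff_orderOf.1 hP x
  obtain ⟨l, hl⟩ := IsPGroup.iff_orderOf.1 hP y
  rw [hk, hl] at h ⊢
  rw [← pow_succ']
  exact Nat.pow_le_pow_right hp.out.pos ((Nat.pow_lt_pow_iff_right hp.out.one_lt).1 h)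

variable [Finite P]

/-- If the center is noncyclic and every maximal cyclic subgroup has order at least `m`, then an
element of order less than `m` has many elements above it. -/
theorem IsPGroup.totient_add_mul_sub_le_overCard (hZ : ¬ IsCyclic (center P)) {m : ℕ}
    (hm : ∀ w : P, GeneratesMaximalCyclic w → m ≤ orderOf w) {x : P} (hx : orderOf x < m) :
    ((orderOf x).totient : ℝ) + p * ((m : ℝ) - orderOf x) ≤ overCard x := by
  obtain ⟨w, hw, hxw⟩ := exists_generatesMaximalCyclic x
  have h1 : (orderOf x).totient + p * (m - orderOf x) ≤ overCard x :=
    le_trans (by gcongr; exact hm w hw) (hP.totient_add_le_overCard hZ hxw)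
  rw [← Nat.cast_sub hx.le]
  exact_mod_cast h1

theorem IsPGroup.card_sub_div_le_overCard [IsCyclic P] (x : P) :
    (Nat.card P : ℝ) - orderOf x / p ≤ overCard x := by
  by_cases hx : x = 1
  · subst hx
    rw [overCard_one]
    have : (0 : ℝ) ≤ (orderOf (1 : P) : ℝ) / p := by positivity
    linarith
  · have h1 : (Nat.card P : ℝ) ≤ overCard x + (orderOf x / p : ℕ) := by
      exact_mod_cast hP.card_le_overCard_add hx
    have h2 : ((orderOf x / p : ℕ) : ℝ) ≤ (orderOf x : ℝ) / p := Nat.cast_div_le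
    linarith

theorem IsPGroup.card_sub_add_totient_le_overCard [IsCyclic P] (x : P) :
    (Nat.card P : ℝ) - orderOf x + (orderOf x).totient ≤ overCard x := by
  by_cases hx : x = 1
  · subst hx
    simp [overCard_one]
  · have := hP.card_sub_div_le_overCard x
    rw [hP.totient_orderOf hx]
    linarith [show (orderOf x : ℝ) * (1 - 1 / p) = orderOf x - orderOf x / p by ring]

end Components

/-! ### Sylow decomposition and the totient conditions. -/

section Nilpotent

/-- A finite nilpotent group is the direct product of a choice of its Sylow subgroups. -/
theorem Group.IsNilpotent.nonempty_mulEquiv_pi_sylow {G : Type*} [Group G] [Finite G]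
    (hG : Group.IsNilpotent G) (S : ∀ p : (Nat.card G).primeFactors, Sylow p G) :
    Nonempty (G ≃* ∀ p : (Nat.card G).primeFactors, (S p : Subgroup G)) := by
  obtain ⟨e⟩ := ((Group.isNilpotent_of_finite_tfae (G := G)).out 0 4).1 hG
  refine ⟨e.symm.trans (MulEquiv.piCongrRight fun p => ?_)⟩
  have : Fact (p : ℕ).Prime := ⟨Nat.prime_of_mem_primeFactors p.2⟩
  -- Normality leaves one Sylow subgroup per prime, so the inner product over Sylow p-subgroups has
  -- a single factor.
  letI := Sylow.unique_of_normal (S p) inferInstance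
  letI : Unique (Sylow p G) := ⟨⟨S p⟩, fun _ => Subsingleton.elim _ _⟩
  exact MulEquiv.piUnique _

theorem totient_prod_of_prime {ι : Type*} {p : ι → ℕ} (hp : ∀ i, (p i).Prime)
    (hinj : Function.Injective p) (T : Finset ι) :
    (∏ i ∈ T, p i).totient = ∏ i ∈ T, (p i - 1) := by
  classical
  induction T using Finset.induction_on with
  | empty => simp
  | insert i T hi ih =>
    rw [Finset.prod_insert hi, Finset.prod_insert hi, Nat.totient_mul, ih, Nat.totient_prime (hp i)]
    refine Nat.Coprime.prod_right fun j hj => (Nat.coprime_primes (hp i) (hp j)).2 fun h => ?_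
    exact hi (hinj h ▸ hj)

theorem one_le_two_mul_prod_of_le_totient {ι : Type*} {p : ι → ℕ} (hp : ∀ i, (p i).Prime)
    (hinj : Function.Injective p) (T : Finset ι)
    (h : ∏ i ∈ T, p i ≤ 2 * (∏ i ∈ T, p i).totient) :
    1 ≤ 2 * ∏ i ∈ T, (1 - 1 / (p i : ℝ)) := by
  have hpos : (0 : ℝ) < ∏ i ∈ T, (p i : ℝ) :=
    Finset.prod_pos fun i _ => by exact_mod_cast (hp i).pos
  have h1 : (∏ i ∈ T, (p i : ℝ)) * ∏ i ∈ T, (1 - 1 / (p i : ℝ)) =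
      ((∏ i ∈ T, p i).totient : ℝ) := by
    rw [totient_prod_of_prime hp hinj, Nat.cast_prod, ← Finset.prod_mul_distrib]
    refine Finset.prod_congr rfl fun i _ => ?_
    have : (p i : ℝ) ≠ 0 := by exact_mod_cast (hp i).ne_zero
    rw [Nat.cast_sub (hp i).one_le]
    field_simp
    simp
  have h2 : (∏ i ∈ T, (p i : ℝ)) ≤ 2 * ((∏ i ∈ T, p i).totient : ℝ) := by exact_mod_cast h
  rw [← h1] at h2
  by_contra! hlt
  nlinarith

/-- If at least two primes occur, the totient condition excludes the prime `2`. -/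
theorem three_le_of_one_le_two_mul_prod {ι : Type*} [Fintype ι] [DecidableEq ι] {p : ι → ℕ}
    (hp : ∀ i, (p i).Prime) (hcard : 2 ≤ Fintype.card ι)
    (h : 1 ≤ 2 * ∏ i, (1 - 1 / (p i : ℝ))) (i : ι) : 3 ≤ p i := by
  by_contra! hlt
  have hi : p i = 2 := le_antisymm (by omega) (hp i).two_le
  have : Nontrivial ι := Fintype.one_lt_card_iff_nontrivial.1 hcard
  obtain ⟨j, hj⟩ := exists_ne i
  have ht : ∀ k, 0 ≤ 1 - 1 / (p k : ℝ) ∧ 1 - 1 / (p k : ℝ) ≤ 1 := fun k =>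
    sub_one_div_mem_Icc (by exact_mod_cast (hp k).two_le)
  have hj1 : 1 - 1 / (p j : ℝ) < 1 := by
    have : (0 : ℝ) < p j := by exact_mod_cast (hp j).pos
    have : 0 < 1 / (p j : ℝ) := by positivity
    linarith
  -- The factor at 2 is 1/2 and the one at j is below 1, so the product would fall below 1/2.
  rw [← Finset.mul_prod_erase _ _ (Finset.mem_univ i),
    ← Finset.mul_prod_erase _ _ (Finset.mem_erase.2 ⟨hj, Finset.mem_univ j⟩), hi] at h
  have h0 : 0 ≤ ∏ k ∈ (Finset.univ.erase i).erase j, (1 - 1 / (p k : ℝ)) :=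
    Finset.prod_nonneg fun k _ => (ht k).1
  have h1 : ∏ k ∈ (Finset.univ.erase i).erase j, (1 - 1 / (p k : ℝ)) ≤ 1 :=
    Finset.prod_le_one (fun k _ => (ht k).1) fun k _ => (ht k).2
  rw [Nat.cast_ofNat] at h
  nlinarith [(ht j).1]

end Nilpotent

/-! ### Minimum degree in a product of p-groups. -/

section Product

variable {G : Type*} [Group G] {ι : Type*} {P : ι → Type*} [∀ i, Group (P i)] [∀ i, Finite (P i)]

theorem powerGraph_degree_add_one [Fintype G] [DecidableRel (powerGraph G).Adj] [Fintype ι]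
    (hco : Pairwise fun i j => (Nat.card (P i)).Coprime (Nat.card (P j)))
    (e : G ≃* ∀ i, P i) (x : G) :
    ((powerGraph G).degree x : ℝ) + 1 =
      ∏ i, (orderOf (e x i) : ℝ) - ∏ i, ((orderOf (e x i)).totient : ℝ) +
        ∏ i, (overCard (e x i) : ℝ) := by
  have h := powerGraph_degree x
  rw [← overCard_mulEquiv e x, overCard_pi hco, ← e.orderOf_eq x, totient_orderOf_pi hco,
    orderOf_pi_eq_prod hco] at h
  have h' := congrArg (Nat.cast (R := ℝ)) h
  push_cast at h'
  linarith

theorem IsMinOrderMaximalCyclic.components [Fintype ι]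
    (hco : Pairwise fun i j => (Nat.card (P i)).Coprime (Nat.card (P j)))
    (e : G ≃* ∀ i, P i) {y : G} (hy : IsMinOrderMaximalCyclic (zpowers y)) :
    (∀ i, GeneratesMaximalCyclic (e y i)) ∧
      ∀ i, ∀ w : P i, GeneratesMaximalCyclic w → orderOf (e y i) ≤ orderOf w := by
  obtain ⟨h1, h2⟩ := isMinOrderMaximalCyclic_zpowers_iff.1 hy
  have h1' := (generatesMaximalCyclic_mulEquiv e).2 h1
  refine ⟨(generatesMaximalCyclic_pi_iff hco).1 h1',
    orderOf_apply_le_of_minOrder hco h1' fun z hz => ?_⟩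
  obtain ⟨g, rfl⟩ := e.surjective z
  rw [e.orderOf_eq, e.orderOf_eq]
  exact h2 g ((generatesMaximalCyclic_mulEquiv e).1 hz)

variable {p : ι → ℕ} [hp : ∀ i, Fact (p i).Prime] (hinj : Function.Injective p)
  (hP : ∀ i, IsPGroup (p i) (P i))
include hinj hP

theorem pairwise_coprime_card :
    Pairwise fun i j => (Nat.card (P i)).Coprime (Nat.card (P j)) := by
  intro i j hij
  obtain ⟨a, ha⟩ := (hP i).exists_card_eq
  obtain ⟨b, hb⟩ := (hP j).exists_card_eq
  rw [ha, hb]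
  exact Nat.Coprime.pow _ _ ((Nat.coprime_primes (hp i).out (hp j).out).2 (hinj.ne hij))

variable [Fintype G] [DecidableRel (powerGraph G).Adj] [Fintype ι] [DecidableEq ι]
  [∀ i, Nontrivial (P i)] (e : G ≃* ∀ i, P i)
include e

theorem minDegree_eq_of_forall_noncyclic (hZ : ∀ i, ¬ IsCyclic (center (P i)))
    (hT : ∀ l, 1 ≤ 2 * ∏ i ∈ Finset.univ.erase l, (1 - 1 / (p i : ℝ))) {y : G}
    (hy : IsMinOrderMaximalCyclic (zpowers y)) :
    (powerGraph G).minDegree = (powerGraph G).degree y := by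
  have hco := pairwise_coprime_card hinj hP
  obtain ⟨hmax, hmin⟩ := hy.components hco e
  refine le_antisymm ((powerGraph G).minDegree_le_degree y)
    ((powerGraph G).le_minDegree_of_forall_le_degree _ fun x => ?_)
  have hx := powerGraph_degree_add_one hco e x
  have hdy := powerGraph_degree_add_one hco e y
  -- For y the totient and overgroup products agree and cancel, leaving the product of the minimum
  -- orders.
  simp only [(hmax _).overCard_eq, sub_add_cancel] at hdy
  have key := prod_le_of_forall_noncyclic (p := fun i => (p i : ℝ))
    (a := fun i => (orderOf (e x i) : ℝ)) (m := fun i => (orderOf (e y i) : ℝ))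
    (f := fun i => ((orderOf (e x i)).totient : ℝ)) (N := fun i => (overCard (e x i) : ℝ))
    (fun i => by
      rcases (hp i).out.two_le.eq_or_lt with h | h
      · left; exact_mod_cast h.symm
      · right; exact_mod_cast h)
    (fun i j h => hinj (Nat.cast_injective (R := ℝ) h))
    (fun i => by exact_mod_cast orderOf_pos _)
    (fun i => by positivity)
    (fun i => by exact_mod_cast Nat.totient_le _)
    (fun i => by exact_mod_cast totient_orderOf_le_overCard _)
    -- The formula φ(a) = a(1 - 1/p) fails at a = 1, which m ≤ a excludes.
    (fun i h => (hP i).totient_orderOf fun h1 => by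
      have h2 : orderOf (e y i) ≤ orderOf (e x i) := by exact_mod_cast h
      rw [h1, orderOf_one] at h2
      exact (hmax i).ne_one (orderOf_eq_one_iff.1 (le_antisymm h2 (orderOf_pos _))))
    (fun i h => by
      have h' : orderOf (e x i) < orderOf (e y i) := by exact_mod_cast h
      exact ⟨by exact_mod_cast (hP i).mul_orderOf_le_of_lt h',
        (hP i).totient_add_mul_sub_le_overCard (hZ i) (hmin i) h'⟩)
    hT
  have : ((powerGraph G).degree y : ℝ) ≤ (powerGraph G).degree x := by
    linarith
  exact_mod_cast this

theorem exists_minDegree_eq_of_cyclic {J : Finset ι} (hJ : J ≠ Finset.univ)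
    (hZ : ∀ i ∈ J, ¬ IsCyclic (center (P i))) (hcyc : ∀ i ∉ J, IsCyclic (P i))
    (hp3 : ∀ i, 3 ≤ p i) (hT : 1 ≤ 2 * ∏ i, (1 - 1 / (p i : ℝ))) :
    ∃ c ∉ J, ∀ y : G, IsMinOrderMaximalCyclic (zpowers y) →
      (powerGraph G).minDegree = (powerGraph G).degree (y ^ Nat.card (P c)) := by
  have hco := pairwise_coprime_card hinj hP
  obtain ⟨c₀, hc₀⟩ : ∃ c, c ∉ J := by
    by_contra! h
    exact hJ (Finset.eq_univ_iff_forall.2 h)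
  by_cases hex : ∃ y : G, IsMinOrderMaximalCyclic (zpowers y)
  swap
  · exact ⟨c₀, hc₀, fun y hy => absurd ⟨y, hy⟩ hex⟩
  obtain ⟨y₀, hy₀⟩ := hex
  obtain ⟨hmax, hmin⟩ := hy₀.components hco e
  -- D c is one more than the degree of y₀ ^ |P c| when c is outside J. The inequality supplies an
  -- index depending on x, so c is chosen to minimise D.
  let D : ι → ℝ := fun c => ∏ i ∈ Finset.univ.erase c, (orderOf (e y₀ i) : ℝ) +
    ((orderOf (e y₀ c) : ℝ) - 1) *
      ∏ i ∈ Finset.univ.erase c, (orderOf (e y₀ i) : ℝ) * (1 - 1 / (p i : ℝ))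
  obtain ⟨c, hc, hcmin⟩ := Finset.exists_min_image (Finset.univ \ J) D
    ⟨c₀, by simpa using hc₀⟩
  simp only [Finset.mem_sdiff, Finset.mem_univ, true_and] at hc hcmin
  have hlower (x : G) : D c ≤ ((powerGraph G).degree x : ℝ) + 1 := by
    rw [powerGraph_degree_add_one hco e x]
    obtain ⟨d, hd, hle⟩ := exists_prod_erase_le (p := fun i => (p i : ℝ))
      (a := fun i => (orderOf (e x i) : ℝ)) (m := fun i => (orderOf (e y₀ i) : ℝ))
      (f := fun i => ((orderOf (e x i)).totient : ℝ)) (N := fun i => (overCard (e x i) : ℝ))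
      hJ
      (fun i => by exact_mod_cast hp3 i)
      (fun i j hij => by
        rcases lt_or_gt_of_ne (hinj.ne hij) with h | h
        · left; exact_mod_cast h
        · right; exact_mod_cast h)
      (fun i => by exact_mod_cast orderOf_pos _)
      (fun i => by exact_mod_cast orderOf_pos (e x i))
      (fun i => by positivity)
      (fun i => by exact_mod_cast Nat.totient_le _)
      (fun i => by exact_mod_cast totient_orderOf_le_overCard _)
      (fun i h => (hP i).totient_orderOf fun h1 => by
        have h2 : orderOf (e y₀ i) ≤ orderOf (e x i) := by exact_mod_cast h
        rw [h1, orderOf_one] at h2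
        exact (hmax i).ne_one (orderOf_eq_one_iff.1 (le_antisymm h2 (orderOf_pos _))))
      (fun i h => by
        have h' : orderOf (e x i) < orderOf (e y₀ i) := by exact_mod_cast h
        exact_mod_cast (hP i).mul_orderOf_le_of_lt h')
      (fun i hi h => (hP i).totient_add_mul_sub_le_overCard (hZ i hi) (hmin i)
        (by exact_mod_cast h))
      (fun i hi => by
        have := hcyc i hi
        rw [(hmax i).orderOf_eq_card]
        exact ⟨(hP i).card_sub_add_totient_le_overCard _, (hP i).card_sub_div_le_overCard _⟩)
      (fun i hi => by
        have := hcyc i hi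
        rw [(hmax i).orderOf_eq_card]
        exact_mod_cast Nat.le_of_dvd Nat.card_pos (orderOf_dvd_natCard _))
      hT
    exact (hcmin d hd).trans hle
  refine ⟨c, hc, fun y hy => ?_⟩
  obtain ⟨hmaxy, hminy⟩ := hy.components hco e
  -- All minimum-order generators have the same component orders, so D computed from y₀ serves every
  -- y.
  have hord (i : ι) : orderOf (e y i) = orderOf (e y₀ i) :=
    le_antisymm (hminy i _ (hmax i)) (hmin i _ (hmaxy i))
  have hdeg : ((powerGraph G).degree (y ^ Nat.card (P c)) : ℝ) + 1 = D c := by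
    -- Raising to |P c| kills the component at c and, by coprimality, preserves the cyclic subgroups
    -- of all others.
    have hmem (i : ι) (hi : i ∈ Finset.univ.erase c) :
        e y i ∈ zpowers ((e y i) ^ Nat.card (P c)) :=
      mem_zpowers_pow_iff.2
        ((hco (Finset.ne_of_mem_erase hi).symm).coprime_dvd_right (orderOf_dvd_natCard _))
    have hordpow (i : ι) (hi : i ∈ Finset.univ.erase c) :
        orderOf ((e y i) ^ Nat.card (P c)) = orderOf (e y₀ i) := by
      rw [← hord i]
      exact Nat.dvd_antisymm (orderOf_dvd_of_mem_zpowers (npow_mem_zpowers _ _))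
        (orderOf_dvd_of_mem_zpowers (hmem i hi))
    have hmaxpow (i : ι) (hi : i ∈ Finset.univ.erase c) :
        GeneratesMaximalCyclic ((e y i) ^ Nat.card (P c)) := fun z hz =>
      zpowers_le.2 (hmem i hi) (hmaxy i z (zpowers_le.2 hz (hmem i hi)))
    have hcycc := hcyc c hc
    have htot (i : ι) : ((orderOf (e y₀ i)).totient : ℝ) =
        orderOf (e y₀ i) * (1 - 1 / (p i : ℝ)) := (hP i).totient_orderOf (hmax i).ne_one
    have hA : ∏ i ∈ Finset.univ.erase c, (orderOf ((e y i) ^ Nat.card (P c)) : ℝ) =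
        ∏ i ∈ Finset.univ.erase c, (orderOf (e y₀ i) : ℝ) :=
      Finset.prod_congr rfl fun i hi => by rw [hordpow i hi]
    have hF : ∏ i ∈ Finset.univ.erase c, ((orderOf ((e y i) ^ Nat.card (P c))).totient : ℝ) =
        ∏ i ∈ Finset.univ.erase c, (orderOf (e y₀ i) : ℝ) * (1 - 1 / (p i : ℝ)) :=
      Finset.prod_congr rfl fun i hi => by rw [hordpow i hi, htot i]
    have hN : ∏ i ∈ Finset.univ.erase c, (overCard ((e y i) ^ Nat.card (P c)) : ℝ) =
        ∏ i ∈ Finset.univ.erase c, (orderOf (e y₀ i) : ℝ) * (1 - 1 / (p i : ℝ)) :=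
      Finset.prod_congr rfl fun i hi => by
        rw [(hmaxpow i hi).overCard_eq, hordpow i hi, htot i]
    rw [powerGraph_degree_add_one hco e]
    simp only [map_pow, Pi.pow_apply]
    rw [← Finset.mul_prod_erase _ _ (Finset.mem_univ c),
      ← Finset.mul_prod_erase _ (fun i => ((orderOf ((e y i) ^ Nat.card (P c))).totient : ℝ))
        (Finset.mem_univ c),
      ← Finset.mul_prod_erase _ (fun i => (overCard ((e y i) ^ Nat.card (P c)) : ℝ))
        (Finset.mem_univ c),
      hA, hF, hN, pow_card_eq_one', overCard_one, orderOf_one, Nat.totient_one, ← (hmax c).orderOf_eq_card]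
    simp only [D, Nat.cast_one]
    ring
  refine le_antisymm ((powerGraph G).minDegree_le_degree _)
    ((powerGraph G).le_minDegree_of_forall_le_degree _ fun x => ?_)
  have : ((powerGraph G).degree (y ^ Nat.card (P c)) : ℝ) ≤ (powerGraph G).degree x := by
    linarith [hlower x]
  exact_mod_cast this

end Product

/-! ### Transfer to the Sylow subgroups of G. -/

theorem mem_noncyclicPrimes {G : Type*} [Group G] {q : ℕ} :
    q ∈ noncyclicPrimes G ↔
      q ∈ (Nat.card G).primeFactors ∧ ∃ P : Sylow q G, ¬ IsCyclic (P : Subgroup G) := by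
  classical exact Finset.mem_filter

theorem theorem1p2 {G : Type*} [Group G] [Fintype G] [DecidableRel (powerGraph G).Adj]
    (hnil : Group.IsNilpotent G) (hnc : ¬ IsCyclic G)
    (hr : 2 ≤ (Nat.card G).primeFactors.card)
    (hZ : ∀ p ∈ noncyclicPrimes G, ∀ P : Sylow p G,
      ¬ IsCyclic (Subgroup.center (P : Subgroup G))) :
    (noncyclicPrimes G ≠ (Nat.card G).primeFactors →
      ∏ p ∈ (Nat.card G).primeFactors, p ≤
        2 * Nat.totient (∏ p ∈ (Nat.card G).primeFactors, p) →
      ∃ q ∈ (Nat.card G).primeFactors \ noncyclicPrimes G,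
        ∀ y : G, IsMinOrderMaximalCyclic (Subgroup.zpowers y) →
          (powerGraph G).minDegree =
            (powerGraph G).degree (y ^ (q ^ (Nat.card G).factorization q))) ∧
    (noncyclicPrimes G = (Nat.card G).primeFactors →
      (∀ l ∈ (Nat.card G).primeFactors,
        ∏ p ∈ (Nat.card G).primeFactors.erase l, p ≤
          2 * Nat.totient (∏ p ∈ (Nat.card G).primeFactors.erase l, p)) →
      ∀ y : G, IsMinOrderMaximalCyclic (Subgroup.zpowers y) →
        (powerGraph G).minDegree = (powerGraph G).degree y) := by
  classical
  let S : ∀ i : (Nat.card G).primeFactors, Sylow i G := fun _ => default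
  have hprime (i : (Nat.card G).primeFactors) : Fact (i : ℕ).Prime :=
    ⟨Nat.prime_of_mem_primeFactors i.2⟩
  obtain ⟨e⟩ := hnil.nonempty_mulEquiv_pi_sylow S
  have hP (i : (Nat.card G).primeFactors) : IsPGroup i (S i : Subgroup G) := (S i).isPGroup'
  have hnontriv (i : (Nat.card G).primeFactors) : Nontrivial (S i : Subgroup G) :=
    (Subgroup.nontrivial_iff_ne_bot _).2 ((S i).ne_bot_of_dvd_card (Nat.dvd_of_mem_primeFactors i.2))
  have hinj : Function.Injective (Subtype.val : (Nat.card G).primeFactors → ℕ) :=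
    Subtype.val_injective
  have hcenter (i : (Nat.card G).primeFactors) (hi : (i : ℕ) ∈ noncyclicPrimes G) :
      ¬ IsCyclic (Subgroup.center (S i : Subgroup G)) := hZ i hi (S i)
  refine ⟨fun hne htot => ?_, fun heq htot y hy => ?_⟩
  · let J : Finset (Nat.card G).primeFactors :=
      Finset.univ.filter fun i => (i : ℕ) ∈ noncyclicPrimes G
    have hJ : J ≠ Finset.univ := by
      intro h
      refine hne (Finset.Subset.antisymm (fun q hq => (mem_noncyclicPrimes.1 hq).1) fun q hq => ?_)
      have : (⟨q, hq⟩ : (Nat.card G).primeFactors) ∈ J := h ▸ Finset.mem_univ _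
      simpa [J] using this
    have hT : 1 ≤ 2 * ∏ i : (Nat.card G).primeFactors, (1 - 1 / ((i : ℕ) : ℝ)) := by
      refine one_le_two_mul_prod_of_le_totient (fun i => (hprime i).out) hinj Finset.univ ?_
      rwa [Finset.prod_coe_sort (Nat.card G).primeFactors fun q => q]
    obtain ⟨c, hc, hdeg⟩ := exists_minDegree_eq_of_cyclic hinj hP e hJ
      (fun i hi => hcenter i (by simpa [J] using hi))
      (fun i hi => by
        by_contra hcyc
        exact hi (Finset.mem_filter.2 ⟨Finset.mem_univ _, mem_noncyclicPrimes.2 ⟨i.2, S i, hcyc⟩⟩))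
      (three_le_of_one_le_two_mul_prod (fun i => (hprime i).out) (by simpa using hr) hT) hT
    refine ⟨c, Finset.mem_sdiff.2 ⟨c.2, by simpa [J] using hc⟩, fun y hy => ?_⟩
    rw [hdeg y hy, (S c).card_eq_multiplicity]
  · refine minDegree_eq_of_forall_noncyclic hinj hP e
      (fun i => hcenter i (heq.symm.subset i.2)) (fun l => ?_) hy
    refine one_le_two_mul_prod_of_le_totient (fun i => (hprime i).out) hinj _ ?_
    have hprod : ∏ i ∈ Finset.univ.erase l, (i : ℕ) =
        ∏ q ∈ (Nat.card G).primeFactors.erase l, q := by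
      refine Finset.prod_bij (fun i _ => (i : ℕ)) (fun i hi => ?_) (fun i _ j _ h => hinj h)
        (fun q hq => ?_) fun _ _ => rfl
      · exact Finset.mem_erase.2 ⟨hinj.ne (Finset.ne_of_mem_erase hi), i.2⟩
      · exact ⟨⟨q, Finset.mem_of_mem_erase hq⟩, Finset.mem_erase.2
          ⟨fun h => Finset.ne_of_mem_erase hq (congrArg Subtype.val h), Finset.mem_univ _⟩, rfl⟩
    rw [hprod]
    exact htot l l.2
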